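/- Let $X$ and $Z$ be real Banach spaces and let $C_0,K\ge 0$ be constants. For a Lipschitz mapping $u$ on a set $S\subset X$, write $\mathrm{Lip}(u)$ for its least Lipschitz constant. Assume: (*) for every subset $S\subset X$, every Lipschitz mapping $u:S\to Z$ and every $\varepsilon>0$ there is a $C^1$ smooth Lipschitz mapping $g:X\to Z$ with $\|u(x)-g(x)\|<\varepsilon$ for all $x\in S$ and $\mathrm{Lip}(g)\le C_0\,\mathrm{Lip}(u)$; (E) for every subset $S\subset X$, every Lipschitz mapping $u:S\to Z$ has a Lipschitz extension $F:X\to Z$ with $\mathrm{Lip}(F)\le K\,\mathrm{Lip}(u)$. Let $A\subset X$ be closed and let $f:A\to Z$ satisfy the mean value condition for a map $D:A\to\mathcal L(X,Z)$; that is, $D$ is continuous for the operator norm and, for every $y\in A$ and $\varepsilon>0$, there is $r>0$ such that $$\|f(z)-f(w)-D(y)(z-w)\|\le\varepsilon\|z-w\|\qquad\text{for all } z,w\in A\cap B(y,r),$$ where $B(y,r)$ is the open ball. Suppose moreover that $f$ is Lipschitz and that $\|D(y)\|\le M$ for all $y\in A$. Then for every real number $c>C_0K\max\{M,\mathrm{Lip}(f)\}$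 there is a $C^1$ smooth Lipschitz mapping $G:X\to Z$ with $G|_A=f$ and $\mathrm{Lip}(G)\le c$. -/

import Mathlib

open scoped NNReal

/-- `f` is Lipschitz on the set `A`, with some constant. -/
def IsLipschitzOn {X Z : Type*} [PseudoEMetricSpace X] [PseudoEMetricSpace Z]
    (f : X → Z) (A : Set X) : Prop :=
  ∃ L : ℝ≥0, LipschitzOnWith L f A

/-- The Lipschitz constant `Lip(f|_A)`: the least `L ≥ 0` such that `f` is `L`-Lipschitz on `A`.
It is only meaningful for maps that are Lipschitz on `A`. -/
noncomputable def lipConst {X Z : Type*} [PseudoEMetricSpace X] [PseudoEMetricSpace Z]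
    (f : X → Z) (A : Set X) : ℝ≥0 :=
  sInf {L : ℝ≥0 | LipschitzOnWith L f A}

/-- The Lipschitz constant is at most every admissible constant. -/
theorem lipConst_le {X Z : Type*} [PseudoEMetricSpace X] [PseudoEMetricSpace Z]
    {f : X → Z} {A : Set X} {L : ℝ≥0} (h : LipschitzOnWith L f A) : lipConst f A ≤ L :=
  csInf_le (OrderBot.bddBelow _) h

/-- The Lipschitz constant is itself admissible. -/
theorem IsLipschitzOn.lipschitzOnWith_lipConst {X Z : Type*} [PseudoMetricSpace X]
    [PseudoMetricSpace Z] {f : X → Z} {A : Set X} (h : IsLipschitzOn f A) :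
    LipschitzOnWith (lipConst f A) f A := by
  refine LipschitzOnWith.of_dist_le_mul fun x hx y hy => ?_
  refine le_of_forall_pos_le_add fun ε hε => ?_
  have hd : 0 < dist x y + 1 := by positivity
  have hq : 0 < ε / (dist x y + 1) := div_pos hε hd
  obtain ⟨L, hL, hlt⟩ := exists_lt_of_csInf_lt (s := {L : ℝ≥0 | LipschitzOnWith L f A}) h
    (b := lipConst f A + (ε / (dist x y + 1)).toNNReal)
    (lt_add_of_pos_right _ (Real.toNNReal_pos.2 hq))
  have h1 : dist (f x) (f y) ≤ L * dist x y := hL.dist_le_mul x hx y hy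
  have h2 : (L : ℝ) ≤ lipConst f A + ε / (dist x y + 1) := by
    have h4 := NNReal.coe_le_coe.2 hlt.le
    rwa [NNReal.coe_add, Real.coe_toNNReal _ hq.le] at h4
  have h3 : ε / (dist x y + 1) * dist x y ≤ ε := by
    rw [div_mul_eq_mul_div, div_le_iff₀ hd]
    nlinarith
  nlinarith [mul_le_mul_of_nonneg_right h2 (dist_nonneg (x := x) (y := y))]

/-- Property (*) of the pair `(X, Z)` with constant `C₀`: Lipschitz maps from arbitrary subsets
of `X` into `Z` can be uniformly approximated, on the subset, by `C¹` Lipschitz maps on all of `X`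
whose Lipschitz constant is at most `C₀` times the original one. -/
def PropertyStar (X Z : Type*) [NormedAddCommGroup X] [NormedSpace ℝ X]
    [NormedAddCommGroup Z] [NormedSpace ℝ Z] (C₀ : ℝ≥0) : Prop :=
  ∀ (A : Set X) (f : X → Z), IsLipschitzOn f A → ∀ ε : ℝ, 0 < ε →
    ∃ g : X → Z, ContDiff ℝ 1 g ∧ LipschitzWith (C₀ * lipConst f A) g ∧
      ∀ x ∈ A, ‖f x - g x‖ < ε

/-- Property (E) of the pair `(X, Z)` with constant `K`: Lipschitz maps from arbitrary subsets of
`X` into `Z` extend to Lipschitz maps on all of `X` whose Lipschitz constant is at most `K` times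
the original one. -/
def PropertyE (X Z : Type*) [NormedAddCommGroup X] [NormedAddCommGroup Z] (K : ℝ≥0) : Prop :=
  ∀ (A : Set X) (f : X → Z), IsLipschitzOn f A →
    ∃ F : X → Z, LipschitzWith (K * lipConst f A) F ∧ Set.EqOn F f A

/-- `f` satisfies the mean value condition on `A` for the map `D`. Only the values of `f` and `D`
on `A` matter. -/
def MeanValueCondition {X Z : Type*} [NormedAddCommGroup X] [NormedSpace ℝ X]
    [NormedAddCommGroup Z] [NormedSpace ℝ Z] (A : Set X) (f : X → Z) (D : X → X →L[ℝ] Z) : Prop :=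
  ContinuousOn D A ∧
    ∀ y ∈ A, ∀ ε : ℝ, 0 < ε → ∃ r : ℝ, 0 < r ∧
      ∀ z ∈ A ∩ Metric.ball y r, ∀ w ∈ A ∩ Metric.ball y r,
        ‖f z - f w - D y (z - w)‖ ≤ ε * ‖z - w‖

/-! The extension is a sum of successive approximations. If R bounds both the Lipschitz constant of
`f` and the norm of `D` on A, then a C¹ map `g` with Lipschitz constant close to C₀KR makes the
residual `f - g`, with `D - g'`, satisfy the same conditions with an arbitrarily small bound
(`BoundedMeanValue.exists_approx`). After the first step the residual bounds can be prescribed to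
decay geometrically, so the Lipschitz constants sum to c and the residuals tend to 0 on A.

One step has three stages. Near y ∈ A the map `f - D y` has a small Lipschitz constant, so `D y`
plus a smoothing of it by (*) is a good local model; glued together, these models give g₀ that is
close to `f` on A in the C¹ and Lipschitz senses. By the mean value inequality g₀ is almost
R-Lipschitz near A. Then (E) extends g₀ from a neighbourhood of A, (*) smooths the extension, and a
second gluing keeps g₀ to first order on A.

Gluing is quantitative because the partition of unity is σ-discrete: layer n has one Lipschitz
constant and one separation scale for all its pieces, so tolerances depending only on n make the
product-rule errors a geometric series. -/

open Filter Topology Metric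

/-! ### Consequences of (*) and (E); smooth bump functions -/

theorem PropertyStar.exists_approx {X Z : Type*} [NormedAddCommGroup X] [NormedSpace ℝ X]
    [NormedAddCommGroup Z] [NormedSpace ℝ Z] {C₀ : ℝ≥0} (hStar : PropertyStar X Z C₀)
    {A : Set X} {u : X → Z} {L : ℝ≥0} (hu : LipschitzOnWith L u A) {ε : ℝ} (hε : 0 < ε) :
    ∃ g : X → Z, ContDiff ℝ 1 g ∧ LipschitzWith (C₀ * L) g ∧ ∀ x ∈ A, ‖u x - g x‖ < ε := by
  obtain ⟨g, hg, hL, h⟩ := hStar A u ⟨L, hu⟩ ε hε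
  exact ⟨g, hg, hL.weaken (mul_le_mul_right (lipConst_le hu) C₀), h⟩

theorem PropertyE.exists_extension {X Z : Type*} [NormedAddCommGroup X]
    [NormedAddCommGroup Z] {K : ℝ≥0} (hE : PropertyE X Z K)
    {A : Set X} {u : X → Z} {L : ℝ≥0} (hu : LipschitzOnWith L u A) :
    ∃ F : X → Z, LipschitzWith (K * L) F ∧ Set.EqOn F u A := by
  obtain ⟨F, hL, h⟩ := hE A u ⟨L, hu⟩
  exact ⟨F, hL.weaken (mul_le_mul_right (lipConst_le hu) K), h⟩

/-- Property (*) forces `C₀ ≥ 1` as soon as there is a nonzero linear map to approximate. -/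
theorem PropertyStar.one_le {X Z : Type*} [NormedAddCommGroup X] [NormedSpace ℝ X]
    [NormedAddCommGroup Z] [NormedSpace ℝ Z] [Nontrivial X] [Nontrivial Z] {C₀ : ℝ≥0}
    (hStar : PropertyStar X Z C₀) : 1 ≤ C₀ := by
  obtain ⟨x, hx⟩ := exists_norm_eq X zero_le_one
  obtain ⟨z, hz⟩ := exists_norm_eq Z zero_le_one
  obtain ⟨φ, hφ, hφx⟩ := exists_dual_vector ℝ x (by rw [← norm_ne_zero_iff, hx]; norm_num)
  have hφx' : φ x = 1 := by rw [hφx, hx]; norm_num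
  have hu : LipschitzWith 1 (fun v => φ v • z) := by
    refine LipschitzWith.of_dist_le_mul fun v w => ?_
    rw [dist_eq_norm, dist_eq_norm, ← sub_smul, ← map_sub, norm_smul, hz]
    simpa [hφ] using φ.le_opNorm (v - w)
  obtain ⟨g, -, hg, h⟩ := hStar.exists_approx (hu.lipschitzOnWith (s := Set.univ)) one_pos
  by_contra! hC
  have hC' : (C₀ : ℝ) < 1 := by exact_mod_cast hC
  set t : ℝ := 2 / (1 - C₀) with ht
  have ht0 : 0 < t := div_pos two_pos (by linarith)
  have h1 := h (t • x) trivial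
  have h2 := h 0 trivial
  have h3 := hg.dist_le_mul (t • x) 0
  simp only [map_smul, hφx', smul_eq_mul, mul_one, map_zero, zero_smul, zero_sub, norm_neg,
    dist_eq_norm, sub_zero] at h1 h2 h3
  rw [norm_smul, hx, mul_one, Real.norm_eq_abs, abs_of_pos ht0] at h3
  have h4 : t ≤ ‖t • z - g (t • x)‖ + ‖g (t • x) - g 0‖ + ‖g 0‖ := by
    have : t • z = (t • z - g (t • x)) + (g (t • x) - g 0) + g 0 := by abel
    have h5 : ‖t • z‖ = t := by rw [norm_smul, hz, mul_one, Real.norm_eq_abs, abs_of_pos ht0]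
    calc t = ‖t • z‖ := h5.symm
      _ = ‖(t • z - g (t • x)) + (g (t • x) - g 0) + g 0‖ := by rw [← this]
      _ ≤ _ := norm_add₃_le
  have h6 : t * (1 - C₀) = 2 := div_mul_cancel₀ _ (by linarith)
  nlinarith

/-- Scalars embed in Z along a unit vector, and a norming functional projects back without
increasing errors. This supplies smooth substitutes for distance functions. -/
theorem PropertyStar.exists_real_approx {X Z : Type*} [NormedAddCommGroup X] [NormedSpace ℝ X]
    [NormedAddCommGroup Z] [NormedSpace ℝ Z] [Nontrivial Z] {C₀ : ℝ≥0}
    (hStar : PropertyStar X Z C₀) {u : X → ℝ} (hu : LipschitzWith 1 u) {ε : ℝ} (hε : 0 < ε) :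
    ∃ h : X → ℝ, ContDiff ℝ 1 h ∧ (∃ L, LipschitzWith L h) ∧ ∀ x, |u x - h x| < ε := by
  obtain ⟨z, hz⟩ := exists_norm_eq Z zero_le_one
  obtain ⟨φ, hφ, hφz⟩ := exists_dual_vector ℝ z (by rw [← norm_ne_zero_iff, hz]; norm_num)
  have hφz' : φ z = 1 := by rw [hφz, hz]; norm_num
  have hu' : LipschitzWith 1 (fun v => u v • z) := by
    refine LipschitzWith.of_dist_le_mul fun v w => ?_
    rw [dist_eq_norm, ← sub_smul, norm_smul, hz, mul_one, ← dist_eq_norm]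
    exact hu.dist_le_mul v w
  obtain ⟨g, hg, hL, h⟩ := hStar.exists_approx (hu'.lipschitzOnWith (s := Set.univ)) hε
  refine ⟨fun x => φ (g x), φ.contDiff.comp hg, ⟨_, φ.lipschitz.comp hL⟩, fun x => ?_⟩
  have h1 : u x - φ (g x) = φ (u x • z - g x) := by simp [hφz']
  rw [h1, ← Real.norm_eq_abs]
  calc ‖φ (u x • z - g x)‖ ≤ ‖φ‖ * ‖u x • z - g x‖ := φ.le_opNorm _
    _ < ε := by rw [hφ, one_mul]; exact h x trivial

/-- The function factors through the projection onto [0, 1], where C¹ and compactness give a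
Lipschitz bound. -/
theorem Real.smoothTransition.exists_lipschitzWith :
    ∃ L, LipschitzWith L Real.smoothTransition := by
  obtain ⟨L, hL⟩ := (Real.smoothTransition.contDiff (n := 1)).contDiffOn.exists_lipschitzOnWith
    one_ne_zero (convex_Icc (0 : ℝ) 1) isCompact_Icc
  refine ⟨L * 1, ?_⟩
  have h := (hL.to_restrict).comp (LipschitzWith.projIcc (zero_le_one' ℝ))
  convert h using 1
  ext x
  simp [Real.smoothTransition.projIcc]

theorem PropertyStar.exists_bump {X Z : Type*} [NormedAddCommGroup X] [NormedSpace ℝ X]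
    [NormedAddCommGroup Z] [NormedSpace ℝ Z] [Nontrivial Z] {C₀ : ℝ≥0}
    (hStar : PropertyStar X Z C₀) (T : Set X) {δ : ℝ} (hδ : 0 < δ) :
    ∃ θ : X → ℝ, ContDiff ℝ 1 θ ∧ (∃ L, LipschitzWith L θ) ∧ (∀ x, 0 ≤ θ x) ∧ (∀ x, θ x ≤ 1) ∧
      (∀ x ∈ T, ∀ᶠ w in 𝓝 x, θ w = 1) ∧ ∀ x, θ x ≠ 0 → ∃ t ∈ T, dist x t < δ := by
  rcases T.eq_empty_or_nonempty with rfl | hT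
  · exact ⟨0, contDiff_const, ⟨0, LipschitzWith.const 0⟩, by simp, by simp, by simp, by simp⟩
  obtain ⟨h, hh, ⟨L, hL⟩, hd⟩ := hStar.exists_real_approx (lipschitz_infDist_pt T)
    (show 0 < δ / 8 by positivity)
  obtain ⟨L', hL'⟩ := Real.smoothTransition.exists_lipschitzWith
  have haff : LipschitzWith (4 / δ).toNNReal (fun t : ℝ => 3 - 4 / δ * t) := by
    refine LipschitzWith.of_dist_le_mul fun v w => ?_
    rw [Real.coe_toNNReal _ (by positivity), Real.dist_eq, Real.dist_eq,
      show 3 - 4 / δ * v - (3 - 4 / δ * w) = - (4 / δ * (v - w)) by ring, abs_neg, abs_mul,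
      abs_of_pos (show 0 < 4 / δ by positivity)]
  -- The argument is at least 1 when `h x ≤ δ / 2` and positive only when `h x < 3 * δ / 4`; the
  -- error δ/8 in `h` fits into both margins.
  refine ⟨fun x => Real.smoothTransition (3 - 4 / δ * h x),
    Real.smoothTransition.contDiff.comp (contDiff_const.sub (contDiff_const.mul hh)),
    ⟨_, hL'.comp (haff.comp hL)⟩, fun x => Real.smoothTransition.nonneg _,
    fun x => Real.smoothTransition.le_one _, fun x hx => ?_, fun x hx => ?_⟩
  · filter_upwards [ball_mem_nhds x (show 0 < δ / 8 by positivity)] with w hw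
    apply Real.smoothTransition.one_of_one_le
    have h1 := infDist_le_dist_of_mem (x := w) hx
    have h2 := abs_lt.1 (hd w)
    have h3 : h w ≤ δ / 2 := by linarith [mem_ball.1 hw]
    have h4 : 4 / δ * h w ≤ 4 / δ * (δ / 2) := by gcongr
    have h5 : 4 / δ * (δ / 2) = 2 := by field_simp; norm_num
    linarith
  · have h1 : 0 < 3 - 4 / δ * h x := by
      by_contra! hc
      exact hx (Real.smoothTransition.zero_of_nonpos hc)
    have h2 := abs_lt.1 (hd x)
    have h3 : h x < 3 * δ / 4 := by
      by_contra! hc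
      have h4 : 4 / δ * (3 * δ / 4) ≤ 4 / δ * h x := by gcongr
      have h5 : 4 / δ * (3 * δ / 4) = 3 := by field_simp
      linarith
    exact (infDist_lt_iff hT).1 (by linarith)

/-! ### σ-discrete partitions of unity -/

/-- A countable partition of unity by `C¹` Lipschitz functions which is subordinate to `U` in the
σ-discrete sense: at scale `δ n`, the support of `χ n` splits into pieces lying in single members
of the cover, and `σ n` tells which member. -/
structure DiscretePartition {X ι : Type*} [NormedAddCommGroup X] [NormedSpace ℝ X]
    (U : ι → Set X) where
  χ : ℕ → X → ℝ
  σ : ℕ → X → ι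
  δ : ℕ → ℝ
  L : ℕ → ℝ≥0
  contDiff : ∀ n, ContDiff ℝ 1 (χ n)
  nonneg : ∀ n x, 0 ≤ χ n x
  le_one : ∀ n x, χ n x ≤ 1
  lipschitz : ∀ n, LipschitzWith (L n) (χ n)
  δ_pos : ∀ n, 0 < δ n
  locallyFinite : ∀ x, ∃ N, ∀ᶠ w in 𝓝 x, ∀ n, N ≤ n → χ n w = 0
  sum_eq_one : ∀ x N, (∀ n, N ≤ n → χ n x = 0) → ∑ n ∈ Finset.range N, χ n x = 1
  discrete : ∀ n x, ∃ i, ∀ w ∈ ball x (δ n), χ n w ≠ 0 → σ n w = i ∧ w ∈ U i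

theorem exists_lipschitzWith_mul {X : Type*} [PseudoMetricSpace X] {a b : X → ℝ}
    (ha : ∃ L, LipschitzWith L a) (hb : ∃ L, LipschitzWith L b)
    (ha1 : ∀ x, |a x| ≤ 1) (hb1 : ∀ x, |b x| ≤ 1) :
    ∃ L, LipschitzWith L (fun x => a x * b x) := by
  obtain ⟨L, hL⟩ := ha
  obtain ⟨L', hL'⟩ := hb
  refine ⟨L + L', LipschitzWith.of_dist_le_mul fun x y => ?_⟩
  have h1 := hL.dist_le_mul x y
  have h2 := hL'.dist_le_mul x y
  rw [Real.dist_eq] at *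
  calc |a x * b x - a y * b y| = |(a x - a y) * b x + a y * (b x - b y)| := by ring_nf
    _ ≤ |a x - a y| * |b x| + |a y| * |b x - b y| := by
      rw [← abs_mul, ← abs_mul]; exact abs_add_le _ _
    _ ≤ |a x - a y| * 1 + 1 * |b x - b y| := by gcongr <;> simp [ha1, hb1]
    _ ≤ _ := by push_cast; linarith

/-- Stone's well-ordering argument: each point is assigned to the first member of the cover
containing it. At depth 2⁻ⁿ inside that member, points assigned to different members are at least
2⁻ⁿ apart. -/
theorem PropertyStar.exists_discretePartition {X Z ι : Type*} [NormedAddCommGroup X]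
    [NormedSpace ℝ X] [NormedAddCommGroup Z] [NormedSpace ℝ Z] [Nontrivial Z] {C₀ : ℝ≥0}
    (hStar : PropertyStar X Z C₀) {U : ι → Set X} (hU : ∀ i, IsOpen (U i))
    (hcov : ∀ x, ∃ i, x ∈ U i) : Nonempty (DiscretePartition U) := by
  classical
  have : Nonempty ι := (hcov 0).nonempty
  let lt : ι → ι → Prop := WellOrderingRel
  let T : ℕ → ι → Set X := fun n i => {x | ball x ((1 / 2) ^ n) ⊆ U i ∧ ∀ j, lt j i → x ∉ U j}
  have hpos : ∀ n : ℕ, (0 : ℝ) < (1 / 2) ^ n := fun n => by positivity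
  have hsep : ∀ n i j s t, s ∈ T n i → t ∈ T n j → dist s t < (1 / 2) ^ n → i = j := by
    intro n i j s t hs ht hst
    rcases trichotomous_of lt i j with h | h | h
    · exact absurd (hs.1 (mem_ball'.2 hst)) (ht.2 i h)
    · exact h
    · exact absurd (ht.1 (mem_ball.2 hst)) (hs.2 j h)
  have hTcov : ∀ x, ∃ n, x ∈ ⋃ i, T n i := by
    intro x
    obtain ⟨i, hi, hmin⟩ := (IsWellFounded.wf (r := lt)).has_min {i | x ∈ U i} (hcov x)
    obtain ⟨ε, hε, hball⟩ := Metric.isOpen_iff.1 (hU i) x hi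
    obtain ⟨n, hn⟩ := exists_pow_lt_of_lt_one hε (show (1 / 2 : ℝ) < 1 by norm_num)
    exact ⟨n, Set.mem_iUnion.2 ⟨i, (ball_subset_ball hn.le).trans hball,
      fun j hj hx => hmin j hx hj⟩⟩
  choose θ hθC hθL hθ0 hθ1 hθT hθsupp using fun n : ℕ =>
    hStar.exists_bump (⋃ i, T n i) (show (0 : ℝ) < (1 / 2) ^ n / 4 by positivity)
  -- The functions `θ n * Q n` telescope to `1 - Q N`. Near a point of level n, `θ n` is identically
  -- 1, so every later `Q` vanishes there; this gives both local finiteness and sum 1.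
  let Q : ℕ → X → ℝ := fun n x => ∏ m ∈ Finset.range n, (1 - θ m x)
  have hQs : ∀ n x, Q (n + 1) x = Q n x * (1 - θ n x) := fun n x => Finset.prod_range_succ _ _
  have hQ0 : ∀ n x, 0 ≤ Q n x := fun n x =>
    Finset.prod_nonneg fun m _ => by linarith [hθ1 m x]
  have hQ1 : ∀ n x, Q n x ≤ 1 := fun n x =>
    Finset.prod_le_one (fun m _ => by linarith [hθ1 m x]) fun m _ => by linarith [hθ0 m x]
  have hQC : ∀ n, ContDiff ℝ 1 (Q n) := fun n =>
    contDiff_prod fun m _ => contDiff_const.sub (hθC m)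
  have hQL : ∀ n, ∃ L, LipschitzWith L (Q n) := by
    intro n
    induction n with
    | zero => exact ⟨0, by simp [Q]⟩
    | succ n ih =>
      have h1 : ∃ L, LipschitzWith L (fun x => 1 - θ n x) := by
        obtain ⟨L, hL⟩ := hθL n
        exact ⟨0 + L, (LipschitzWith.const (1 : ℝ)).sub hL⟩
      have h2 := exists_lipschitzWith_mul ih h1
        (fun x => abs_le.2 ⟨by linarith [hQ0 n x], hQ1 n x⟩)
        (fun x => abs_le.2 ⟨by linarith [hθ1 n x], by linarith [hθ0 n x]⟩)
      simpa only [← hQs] using h2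
  have hχL : ∀ n, ∃ L, LipschitzWith L (fun x => θ n x * Q n x) := fun n =>
    exists_lipschitzWith_mul (hθL n) (hQL n)
      (fun x => abs_le.2 ⟨by linarith [hθ0 n x], hθ1 n x⟩)
      (fun x => abs_le.2 ⟨by linarith [hQ0 n x], hQ1 n x⟩)
  choose L hL using hχL
  have hsum : ∀ N x, ∑ n ∈ Finset.range N, θ n x * Q n x = 1 - Q N x := by
    intro N x
    induction N with
    | zero => simp [Q]
    | succ N ih => rw [Finset.sum_range_succ, ih, hQs]; ring
  have hvan : ∀ n x, θ n x = 1 → ∀ m, n + 1 ≤ m → Q m x = 0 := by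
    intro n x hx m hm
    exact Finset.prod_eq_zero (Finset.mem_range.2 hm) (by rw [hx, sub_self])
  let near : ℕ → X → ι → Prop := fun n w i => ∃ t ∈ T n i, dist w t < (1 / 2) ^ n / 4
  -- The default index is harmless: `σ` matters only where the layer is nonzero.
  let σ : ℕ → X → ι := fun n w => if h : ∃ i, near n w i then h.choose else Classical.arbitrary ι
  have hσ : ∀ n w, θ n w * Q n w ≠ 0 → near n w (σ n w) := by
    intro n w hw
    obtain ⟨t, ht, hd⟩ := hθsupp n w (left_ne_zero_of_mul hw)
    obtain ⟨i, hi⟩ := Set.mem_iUnion.1 ht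
    have hex : ∃ i, near n w i := ⟨i, t, hi, hd⟩
    simp only [σ, dif_pos hex]
    exact hex.choose_spec
  refine ⟨⟨fun n x => θ n x * Q n x, σ, fun n => (1 / 2) ^ n / 4, L,
    fun n => (hθC n).mul (hQC n), fun n x => mul_nonneg (hθ0 n x) (hQ0 n x),
    fun n x => mul_le_one₀ (hθ1 n x) (hQ0 n x) (hQ1 n x), hL, fun n => by positivity,
    fun x => ?_, fun x N hN => ?_, fun n x => ?_⟩⟩
  · obtain ⟨n, hn⟩ := hTcov x
    refine ⟨n + 1, ?_⟩
    filter_upwards [hθT n x hn] with w hw m hm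
    rw [hvan n w hw m hm, mul_zero]
  · obtain ⟨n, hn⟩ := hTcov x
    have h1 := hvan n x (hθT n x hn).self_of_nhds
    have h2 : ∑ m ∈ Finset.range (max N (n + 1)), θ m x * Q m x = 1 := by
      rw [hsum, h1 _ (le_max_right _ _), sub_zero]
    rw [← h2]
    refine Finset.sum_subset (Finset.range_mono (le_max_left _ _)) fun m _ hm => ?_
    exact hN m (by simpa using hm)
  · by_cases hw : ∃ w ∈ ball x ((1 / 2) ^ n / 4), θ n w * Q n w ≠ 0
    · obtain ⟨w, hwx, hw⟩ := hw
      obtain ⟨t, ht, hd⟩ := hσ n w hw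
      refine ⟨σ n w, fun v hvx hv => ?_⟩
      obtain ⟨s, hs, hds⟩ := hσ n v hv
      -- Four distances below 2⁻ⁿ/4 lead from s to t through v, x and w, which is less than the
      -- separation of different indices.
      have heq : σ n v = σ n w := by
        refine hsep n _ _ s t hs ht ?_
        have h1 := dist_triangle4 s v w t
        have h2 := dist_triangle_right v w x
        rw [dist_comm s v] at h1
        linarith [mem_ball.1 hwx, mem_ball.1 hvx]
      refine ⟨heq, heq ▸ hs.1 (mem_ball.2 ?_)⟩
      linarith [hpos n]
    · push Not at hw
      exact ⟨Classical.arbitrary ι, fun w hwx hne => absurd (hw w hwx) hne⟩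

/-! ### Gluing local pieces -/

namespace DiscretePartition

variable {X Z ι : Type*} [NormedAddCommGroup X] [NormedSpace ℝ X] [NormedAddCommGroup Z]
  [NormedSpace ℝ Z] {U : ι → Set X}

theorem mem_of_ne_zero (P : DiscretePartition U) {n : ℕ} {x : X} (h : P.χ n x ≠ 0) :
    x ∈ U (P.σ n x) := by
  obtain ⟨i, hi⟩ := P.discrete n x
  obtain ⟨h1, h2⟩ := hi x (mem_ball_self (P.δ_pos n)) h
  rwa [h1]

theorem fderiv_eq_zero (P : DiscretePartition U) {n : ℕ} {x : X} (h : P.χ n x = 0) :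
    fderiv ℝ (P.χ n) x = 0 :=
  IsLocalMin.fderiv_eq_zero (Eventually.of_forall fun w => by rw [h]; exact P.nonneg n w)

theorem norm_fderiv_le (P : DiscretePartition U) (n : ℕ) (x : X) :
    ‖fderiv ℝ (P.χ n) x‖ ≤ P.L n :=
  norm_fderiv_le_of_lipschitz ℝ (P.lipschitz n)

theorem sum_fderiv_eq_zero (P : DiscretePartition U) {x : X} {N : ℕ}
    (hN : ∀ᶠ w in 𝓝 x, ∀ n, N ≤ n → P.χ n w = 0) :
    ∑ n ∈ Finset.range N, fderiv ℝ (P.χ n) x = 0 := by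
  have h1 : HasFDerivAt (fun w => ∑ n ∈ Finset.range N, P.χ n w)
      (∑ n ∈ Finset.range N, fderiv ℝ (P.χ n) x) x :=
    HasFDerivAt.fun_sum fun n _ =>
      ((P.contDiff n).differentiable one_ne_zero x).hasFDerivAt
  have h2 : (fun w => ∑ n ∈ Finset.range N, P.χ n w) =ᶠ[𝓝 x] fun _ => (1 : ℝ) :=
    hN.mono fun w hw => P.sum_eq_one w N hw
  exact h1.unique ((hasFDerivAt_const (1 : ℝ) x).congr_of_eventuallyEq h2)

/-- The `n`-th layer of the map glued from the local pieces `g n i`. -/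
noncomputable def layer (P : DiscretePartition U) (g : ℕ → ι → X → Z) (n : ℕ) (x : X) : Z :=
  P.χ n x • g n (P.σ n x) x

/-- The map glued from the local pieces `g n i`. -/
noncomputable def glue (P : DiscretePartition U) (g : ℕ → ι → X → Z) (x : X) : Z :=
  ∑' n, P.layer g n x

variable (P : DiscretePartition U) {g : ℕ → ι → X → Z}

/-- The index `σ` may jump, but near x all active points share one index, so the layer is locally a
product of C¹ maps. -/
theorem layer_eventuallyEq (n : ℕ) (x : X) :
    ∃ i, P.layer g n =ᶠ[𝓝 x] (fun w => P.χ n w • g n i w) ∧ (P.χ n x ≠ 0 → P.σ n x = i) := by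
  obtain ⟨i, hi⟩ := P.discrete n x
  refine ⟨i, ?_, fun h => (hi x (mem_ball_self (P.δ_pos n)) h).1⟩
  filter_upwards [ball_mem_nhds x (P.δ_pos n)] with w hw
  by_cases h : P.χ n w = 0
  · simp [layer, h]
  · simp [layer, (hi w hw h).1]

theorem contDiff_layer (hg : ∀ n i, ContDiff ℝ 1 (g n i)) (n : ℕ) :
    ContDiff ℝ 1 (P.layer g n) := by
  refine contDiff_iff_contDiffAt.2 fun x => ?_
  obtain ⟨i, hi, -⟩ := P.layer_eventuallyEq (g := g) n x
  exact ((P.contDiff n).smul (hg n i)).contDiffAt.congr_of_eventuallyEq hi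

theorem hasFDerivAt_layer (hg : ∀ n i, ContDiff ℝ 1 (g n i)) (n : ℕ) (x : X) :
    HasFDerivAt (P.layer g n) (P.χ n x • fderiv ℝ (g n (P.σ n x)) x +
      (fderiv ℝ (P.χ n) x).smulRight (g n (P.σ n x) x)) x := by
  obtain ⟨i, hi, hσ⟩ := P.layer_eventuallyEq (g := g) n x
  have h1 := (((P.contDiff n).differentiable one_ne_zero x).hasFDerivAt.smul
    ((hg n i).differentiable one_ne_zero x).hasFDerivAt).congr_of_eventuallyEq hi
  by_cases h : P.χ n x = 0
  · convert h1 using 1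
    simp [h, P.fderiv_eq_zero h]
  · rw [hσ h]
    exact h1

theorem glue_eq_sum {x : X} {N : ℕ} (hN : ∀ n, N ≤ n → P.χ n x = 0) :
    P.glue g x = ∑ n ∈ Finset.range N, P.layer g n x :=
  tsum_eq_sum fun n hn => by simp [layer, hN n (by simpa using hn)]

theorem contDiff_glue (hg : ∀ n i, ContDiff ℝ 1 (g n i)) : ContDiff ℝ 1 (P.glue g) := by
  refine contDiff_iff_contDiffAt.2 fun x => ?_
  obtain ⟨N, hN⟩ := P.locallyFinite x
  have h1 : ContDiff ℝ 1 fun w => ∑ n ∈ Finset.range N, P.layer g n w :=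
    ContDiff.sum fun n _ => P.contDiff_layer hg n
  exact h1.contDiffAt.congr_of_eventuallyEq (hN.mono fun w hw => P.glue_eq_sum hw)

theorem glue_eq_of_forall {x : X} {p : Z} (h : ∀ n, P.χ n x ≠ 0 → g n (P.σ n x) x = p) :
    P.glue g x = p := by
  obtain ⟨N, hN⟩ := P.locallyFinite x
  rw [P.glue_eq_sum hN.self_of_nhds]
  calc ∑ n ∈ Finset.range N, P.layer g n x = ∑ n ∈ Finset.range N, P.χ n x • p := by
        refine Finset.sum_congr rfl fun n _ => ?_
        by_cases hn : P.χ n x = 0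
        · simp [layer, hn]
        · rw [layer, h n hn]
    _ = p := by rw [← Finset.sum_smul, P.sum_eq_one x N hN.self_of_nhds, one_smul]

theorem sum_geometric_le {β : ℝ} (hβ : 0 ≤ β) (N : ℕ) :
    ∑ n ∈ Finset.range N, β * (1 / 2) ^ (n + 1) ≤ β := by
  have h : ∑ n ∈ Finset.range N, β * (1 / 2) ^ (n + 1) = β * (1 - (1 / 2) ^ N) := by
    induction N with
    | zero => simp
    | succ N ih => rw [Finset.sum_range_succ, ih]; ring
  rw [h]
  exact mul_le_of_le_one_right hβ (by linarith [show (0 : ℝ) ≤ (1 / 2) ^ N by positivity])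

/-- If the active pieces have derivative `α`-close to `T` and value sufficiently close to a common
value `p`, then the derivative of the glued map is `α + β`-close to `T`. -/
theorem norm_fderiv_glue_sub_le (hg : ∀ n i, ContDiff ℝ 1 (g n i)) {x : X} {p : Z} {T : X →L[ℝ] Z}
    {α β : ℝ} (hβ : 0 ≤ β) (hα : ∀ n, P.χ n x ≠ 0 → ‖fderiv ℝ (g n (P.σ n x)) x - T‖ ≤ α)
    (hp : ∀ n, P.χ n x ≠ 0 → P.L n * ‖g n (P.σ n x) x - p‖ ≤ β * (1 / 2) ^ (n + 1)) :
    ‖fderiv ℝ (P.glue g) x - T‖ ≤ α + β := by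
  obtain ⟨N, hN⟩ := P.locallyFinite x
  have h1 : HasFDerivAt (P.glue g) (∑ n ∈ Finset.range N, (P.χ n x • fderiv ℝ (g n (P.σ n x)) x +
      (fderiv ℝ (P.χ n) x).smulRight (g n (P.σ n x) x))) x :=
    (HasFDerivAt.fun_sum fun n _ => P.hasFDerivAt_layer hg n x).congr_of_eventuallyEq
      (hN.mono fun w hw => P.glue_eq_sum hw)
  have hs := P.sum_eq_one x N hN.self_of_nhds
  -- Since the χ's sum to 1 and their derivatives to 0, both `T` and the common value `p` can be
  -- subtracted inside the sum.
  have h2 : fderiv ℝ (P.glue g) x - T = ∑ n ∈ Finset.range N,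
      (P.χ n x • (fderiv ℝ (g n (P.σ n x)) x - T) +
        (fderiv ℝ (P.χ n) x).smulRight (g n (P.σ n x) x - p)) := by
    have h3 : ∑ n ∈ Finset.range N, P.χ n x • T = T := by
      rw [← Finset.sum_smul, hs, one_smul]
    have h4 : ∑ n ∈ Finset.range N, (fderiv ℝ (P.χ n) x).smulRight p = 0 := by
      have h5 := P.sum_fderiv_eq_zero hN
      ext v
      have h6 := DFunLike.congr_fun h5 v
      simp only [sum_apply, ContinuousLinearMap.smulRight_apply,
        zero_apply] at h6 ⊢
      rw [← Finset.sum_smul, h6, zero_smul]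
    have h7 : ∀ n, (fderiv ℝ (P.χ n) x).smulRight (g n (P.σ n x) x - p) =
        (fderiv ℝ (P.χ n) x).smulRight (g n (P.σ n x) x) - (fderiv ℝ (P.χ n) x).smulRight p := by
      intro n
      ext v
      simp [smul_sub]
    simp only [h7, smul_sub, Finset.sum_add_distrib, Finset.sum_sub_distrib, h3, h4, h1.fderiv]
    abel
  rw [h2]
  calc _ ≤ ∑ n ∈ Finset.range N, (P.χ n x * α + β * (1 / 2) ^ (n + 1)) := by
        refine norm_sum_le_of_le _ fun n _ => ?_
        by_cases hn : P.χ n x = 0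
        · simp only [hn, P.fderiv_eq_zero hn, zero_smul, zero_mul, zero_add]
          have h8 : (0 : X →L[ℝ] ℝ).smulRight (g n (P.σ n x) x - p) = 0 := by ext v; simp
          rw [h8, norm_zero]
          positivity
        · refine (norm_add_le _ _).trans (add_le_add ?_ ?_)
          · rw [norm_smul, Real.norm_eq_abs, abs_of_nonneg (P.nonneg n x)]
            exact mul_le_mul_of_nonneg_left (hα n hn) (P.nonneg n x)
          · rw [ContinuousLinearMap.norm_smulRight_apply]
            exact (mul_le_mul_of_nonneg_right (P.norm_fderiv_le n x) (norm_nonneg _)).trans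
              (hp n hn)
    _ = α + ∑ n ∈ Finset.range N, β * (1 / 2) ^ (n + 1) := by
        rw [Finset.sum_add_distrib, ← Finset.sum_mul, hs, one_mul]
    _ ≤ α + β := by gcongr; exact sum_geometric_le hβ N

/-- Gluing pieces that are close to `f` on `A`, with small Lipschitz errors there, gives a map
whose error on `A` has a small Lipschitz constant. -/
theorem lipschitzOnWith_sub_glue {A : Set X} {f : X → Z} {a b : ℝ≥0} {e : ℕ → ℝ}
    (hlip : ∀ n i, LipschitzOnWith a (fun x => f x - g n i x) (A ∩ U i))
    (hsmall : ∀ n i, ∀ x ∈ A ∩ U i, ‖f x - g n i x‖ ≤ e n)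
    (he : ∀ n, (P.L n + 2 / P.δ n) * e n ≤ b * (1 / 2) ^ (n + 1)) (he0 : ∀ n, 0 ≤ e n) :
    LipschitzOnWith (a + b) (fun x => f x - P.glue g x) A := by
  refine LipschitzOnWith.of_dist_le_mul fun z hz w hw => ?_
  rw [dist_eq_norm, dist_eq_norm]
  obtain ⟨N₁, hN₁⟩ := P.locallyFinite z
  obtain ⟨N₂, hN₂⟩ := P.locallyFinite w
  let N := max N₁ N₂
  have hz0 : ∀ n, N ≤ n → P.χ n z = 0 := fun n hn =>
    hN₁.self_of_nhds n ((le_max_left _ _).trans hn)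
  have hw0 : ∀ n, N ≤ n → P.χ n w = 0 := fun n hn =>
    hN₂.self_of_nhds n ((le_max_right _ _).trans hn)
  let err : ℕ → X → Z := fun n x => P.χ n x • (f x - g n (P.σ n x) x)
  have hsum : ∀ x, (∀ n, N ≤ n → P.χ n x = 0) →
      f x - P.glue g x = ∑ n ∈ Finset.range N, err n x := by
    intro x hx
    simp only [err, smul_sub, Finset.sum_sub_distrib, ← Finset.sum_smul, P.sum_eq_one x N hx,
      one_smul, P.glue_eq_sum hx, layer]
  have hbound : ∀ n, ∀ x ∈ A, P.χ n x ≠ 0 → ‖f x - g n (P.σ n x) x‖ ≤ e n := fun n x hx h =>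
    hsmall n _ x ⟨hx, P.mem_of_ne_zero h⟩
  have herr : ∀ n, ∀ x ∈ A, ‖err n x‖ ≤ P.χ n x * e n := by
    intro n x hx
    by_cases h : P.χ n x = 0
    · simp [err, h]
    · rw [norm_smul, Real.norm_eq_abs, abs_of_nonneg (P.nonneg n x)]
      exact mul_le_mul_of_nonneg_left (hbound n x hx h) (P.nonneg n x)
  have hχ : ∀ n, |P.χ n z - P.χ n w| ≤ P.L n * ‖z - w‖ := fun n => by
    have := (P.lipschitz n).dist_le_mul z w
    rwa [Real.dist_eq, dist_eq_norm] at this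
  -- Points at distance at least `δ n` are handled by size alone, whence the term 2/δ. For closer
  -- points, either one is inactive and the Lipschitz bound on χ suffices, or both use the same
  -- piece and the product rule applies.
  have hterm : ∀ n, ‖err n z - err n w‖ ≤
      P.χ n z * (a * ‖z - w‖) + (P.L n + 2 / P.δ n) * e n * ‖z - w‖ := by
    intro n
    have hδ := P.δ_pos n
    have hn := he0 n
    have hchi := P.nonneg n z
    have hχn := mul_le_mul_of_nonneg_right (hχ n) hn
    have hextra : 0 ≤ 2 / P.δ n * e n * ‖z - w‖ := by positivity
    have hextra' : 0 ≤ P.χ n z * (a * ‖z - w‖) := by positivity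
    have hextra'' : 0 ≤ P.L n * e n * ‖z - w‖ := by positivity
    by_cases hd : dist w z < P.δ n
    · by_cases h1 : P.χ n z = 0
      · have h2 : err n z = 0 := by simp [err, h1]
        rw [h2, zero_sub, norm_neg]
        have h3 := herr n w hw
        rw [h1, zero_sub, abs_neg, abs_of_nonneg (P.nonneg n w)] at hχn
        linarith
      by_cases h2 : P.χ n w = 0
      · have h3 : err n w = 0 := by simp [err, h2]
        rw [h3, sub_zero]
        have h3 := herr n z hz
        rw [h2, sub_zero, abs_of_nonneg hchi] at hχn
        linarith
      obtain ⟨i, hi⟩ := P.discrete n z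
      obtain ⟨hσz, hUz⟩ := hi z (mem_ball_self hδ) h1
      obtain ⟨hσw, hUw⟩ := hi w hd h2
      have h3 : err n z - err n w = P.χ n z • ((f z - g n i z) - (f w - g n i w)) +
          (P.χ n z - P.χ n w) • (f w - g n i w) := by
        simp only [err, hσz, hσw, smul_sub, sub_smul]
        abel
      have h4 := (hlip n i).dist_le_mul z ⟨hz, hUz⟩ w ⟨hw, hUw⟩
      rw [dist_eq_norm, dist_eq_norm] at h4
      have h5 : ‖P.χ n z • ((f z - g n i z) - (f w - g n i w))‖ ≤ P.χ n z * (a * ‖z - w‖) := by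
        rw [norm_smul, Real.norm_eq_abs, abs_of_nonneg hchi]
        exact mul_le_mul_of_nonneg_left h4 hchi
      have h6 : ‖(P.χ n z - P.χ n w) • (f w - g n i w)‖ ≤ P.L n * ‖z - w‖ * e n := by
        rw [norm_smul, Real.norm_eq_abs]
        exact mul_le_mul (hχ n) (hsmall n i w ⟨hw, hUw⟩) (norm_nonneg _) (by positivity)
      rw [h3]
      refine (norm_add_le _ _).trans ?_
      linarith
    · rw [not_lt, dist_comm, dist_eq_norm] at hd
      have h1 : ‖err n z - err n w‖ ≤ 2 * e n := by
        have h2 := herr n z hz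
        have h3 := herr n w hw
        have h4 := mul_le_of_le_one_left hn (P.le_one n z)
        have h5 := mul_le_of_le_one_left hn (P.le_one n w)
        linarith [norm_sub_le (err n z) (err n w)]
      have h2 : 2 * e n ≤ 2 / P.δ n * e n * ‖z - w‖ := by
        rw [div_mul_eq_mul_div, div_mul_eq_mul_div, le_div_iff₀ hδ]
        exact mul_le_mul_of_nonneg_left hd (by positivity)
      linarith
  rw [hsum z hz0, hsum w hw0, ← Finset.sum_sub_distrib]
  calc _ ≤ ∑ n ∈ Finset.range N,
          (P.χ n z * (a * ‖z - w‖) + b * (1 / 2) ^ (n + 1) * ‖z - w‖) := by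
        refine norm_sum_le_of_le _ fun n _ => (hterm n).trans ?_
        exact add_le_add_right (mul_le_mul_of_nonneg_right (he n) (norm_nonneg _)) _
    _ = (a + ∑ n ∈ Finset.range N, (b : ℝ) * (1 / 2) ^ (n + 1)) * ‖z - w‖ := by
        rw [Finset.sum_add_distrib, ← Finset.sum_mul, ← Finset.sum_mul, P.sum_eq_one z N hz0]
        ring
    _ ≤ _ := by
        push_cast
        gcongr
        exact sum_geometric_le b.2 N

end DiscretePartition

/-! ### One approximation step -/

section Approximation

variable {X Z : Type*} [NormedAddCommGroup X] [NormedSpace ℝ X] [NormedAddCommGroup Z]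
  [NormedSpace ℝ Z] {C₀ K : ℝ≥0} {A : Set X}

/-- A C¹ map is strictly differentiable, hence satisfies the mean value condition for its own
derivative. -/
theorem MeanValueCondition.sub_contDiff {f g : X → Z} {D : X → X →L[ℝ] Z}
    (hD : MeanValueCondition A f D) (hg : ContDiff ℝ 1 g) :
    MeanValueCondition A (f - g) (D - fderiv ℝ g) := by
  refine ⟨hD.1.sub (hg.continuous_fderiv one_ne_zero).continuousOn, fun y hy ε hε => ?_⟩
  obtain ⟨r, hr, h⟩ := hD.2 y hy (ε / 2) (half_pos hε)
  have hs := (hg.contDiffAt (x := y)).hasStrictFDerivAt one_ne_zero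
  have h1 := hs.isLittleO.def (half_pos hε)
  obtain ⟨s, hs0, h2⟩ := Metric.eventually_nhds_iff_ball.1 h1
  refine ⟨min r s, lt_min hr hs0, fun z hz w hw => ?_⟩
  have h3 := h z ⟨hz.1, ball_subset_ball (min_le_left _ _) hz.2⟩ w
    ⟨hw.1, ball_subset_ball (min_le_left _ _) hw.2⟩
  have h4 := h2 (z, w) (by
    rw [← ball_prod_same]
    exact ⟨ball_subset_ball (min_le_right _ _) hz.2, ball_subset_ball (min_le_right _ _) hw.2⟩)
  have h5 : (f - g) z - (f - g) w - (D - fderiv ℝ g) y (z - w) =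
      (f z - f w - D y (z - w)) - (g z - g w - fderiv ℝ g y (z - w)) := by
    simp only [Pi.sub_apply, sub_apply]
    abel
  rw [h5]
  refine (norm_sub_le _ _).trans ?_
  simp only at h4
  linarith

/-- A map satisfying the mean value condition on a closed set is the restriction, up to small
errors in the `C¹` and Lipschitz sense on this set, of a `C¹` map (without global control). -/
theorem MeanValueCondition.exists_contDiff_approx [Nontrivial Z] (hStar : PropertyStar X Z C₀)
    (hA : IsClosed A) {f : X → Z} {D : X → X →L[ℝ] Z} (hD : MeanValueCondition A f D)
    {ε : ℝ≥0} (hε : 0 < ε) :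
    ∃ g : X → Z, ContDiff ℝ 1 g ∧ LipschitzOnWith ε (fun x => f x - g x) A ∧
      ∀ y ∈ A, ‖fderiv ℝ g y - D y‖ ≤ ε := by
  -- `f - D y` and its smoothing contribute τ and C₀τ, together ε/2; the other half of ε is left for
  -- gluing.
  set τ : ℝ≥0 := ε / 2 / (C₀ + 1) with hτdef
  have hτ : 0 < τ := by positivity
  have hτε : τ + C₀ * τ = ε / 2 := by
    rw [hτdef, ← one_add_mul, add_comm 1, mul_div_cancel₀]
    positivity
  have hτε' : (τ : ℝ) + C₀ * τ = ε / 2 := by exact_mod_cast congrArg NNReal.toReal hτε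
  have hr : ∀ y : A, ∃ r : ℝ, 0 < r ∧
      LipschitzOnWith τ (fun x => f x - D y x) (A ∩ ball (y : X) r) ∧
      ∀ x ∈ A ∩ ball (y : X) r, ‖D y - D x‖ ≤ τ := by
    rintro ⟨y, hy⟩
    obtain ⟨r, hr, h⟩ := hD.2 y hy τ hτ
    obtain ⟨s, hs, h'⟩ := Metric.continuousOn_iff.1 hD.1 y hy τ hτ
    refine ⟨min r s, lt_min hr hs, LipschitzOnWith.of_dist_le_mul fun z hz w hw => ?_,
      fun x hx => ?_⟩
    · have := h z ⟨hz.1, ball_subset_ball (min_le_left _ _) hz.2⟩ w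
        ⟨hw.1, ball_subset_ball (min_le_left _ _) hw.2⟩
      rw [dist_eq_norm, dist_eq_norm]
      rwa [map_sub, sub_sub_sub_comm] at this
    · rw [← dist_eq_norm, dist_comm]
      exact (h' x hx.1 (ball_subset_ball (min_le_right _ _) hx.2)).le
  choose r hr0 hrL hrD using hr
  -- The index `none` covers the complement of A, where no approximation is required, so its piece
  -- can be 0.
  let U : Option A → Set X := fun i => i.elim Aᶜ fun y => ball (y : X) (r y)
  have hU : ∀ i, IsOpen (U i) := by
    rintro (_ | y)
    · exact hA.isOpen_compl
    · exact isOpen_ball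
  have hcov : ∀ x, ∃ i, x ∈ U i := by
    intro x
    by_cases hx : x ∈ A
    · exact ⟨some ⟨x, hx⟩, mem_ball_self (hr0 _)⟩
    · exact ⟨none, hx⟩
  obtain ⟨P⟩ := hStar.exists_discretePartition hU hcov
  let e : ℕ → ℝ := fun n => (ε / 2 : ℝ≥0) * (1 / 2) ^ (n + 1) / (P.L n + 2 / P.δ n)
  have hden : ∀ n, 0 < P.L n + 2 / P.δ n := fun n => by
    have := P.δ_pos n
    positivity
  have he0 : ∀ n, 0 < e n := fun n => by
    have := hden n
    positivity
  have he : ∀ n, (P.L n + 2 / P.δ n) * e n = (ε / 2 : ℝ≥0) * (1 / 2) ^ (n + 1) := fun n =>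
    mul_div_cancel₀ _ (hden n).ne'
  have hpiece : ∀ (n : ℕ) (i : Option A), ∃ g : X → Z, ContDiff ℝ 1 g ∧
      LipschitzOnWith (ε / 2) (fun x => f x - g x) (A ∩ U i) ∧
      (∀ x ∈ A ∩ U i, ‖f x - g x‖ ≤ e n) ∧
      ∀ x ∈ A ∩ U i, ‖fderiv ℝ g x - D x‖ ≤ (ε / 2 : ℝ≥0) := by
    rintro n (_ | y)
    · have hempty : A ∩ U none = ∅ := Set.inter_compl_self A
      rw [hempty]
      exact ⟨0, contDiff_const, by simp, by simp, by simp⟩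
    · obtain ⟨h, hh, hL, hd⟩ := hStar.exists_approx (hrL y) (he0 n)
      refine ⟨fun x => D y x + h x, (D y).contDiff.add hh, ?_, fun x hx => ?_, fun x hx => ?_⟩
      · have h1 := (hrL y).sub (hL.lipschitzOnWith (s := A ∩ ball (y : X) (r y)))
        rw [hτε] at h1
        simp only [sub_add_eq_sub_sub]
        exact h1
      · rw [sub_add_eq_sub_sub]
        exact (hd x hx).le
      · have h1 : fderiv ℝ (fun x => D y x + h x) x = D y + fderiv ℝ h x := by
          have := (D y).hasFDerivAt.add (hh.differentiable one_ne_zero x).hasFDerivAt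
          exact this.fderiv
        have h2 := norm_fderiv_le_of_lipschitz ℝ hL (x₀ := x)
        push_cast at h2 ⊢
        rw [h1, ← hτε', add_sub_right_comm]
        exact (norm_add_le _ _).trans (add_le_add (hrD y x hx) h2)
  choose g hgC hgL hgsmall hgD using hpiece
  refine ⟨P.glue g, P.contDiff_glue hgC, ?_, fun y hy => ?_⟩
  · have := P.lipschitzOnWith_sub_glue hgL hgsmall (fun n => (he n).le) fun n => (he0 n).le
    rwa [add_halves] at this
  · have h1 := P.norm_fderiv_glue_sub_le (α := (ε / 2 : ℝ≥0)) (β := (ε / 2 : ℝ≥0)) hgC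
      (NNReal.coe_nonneg _) (fun n hn => hgD n _ y ⟨hy, P.mem_of_ne_zero hn⟩)
      (p := f y) (fun n hn => ?_)
    · rwa [← NNReal.coe_add, add_halves] at h1
    · rw [norm_sub_rev, ← he n]
      have h2 : (P.L n : ℝ) ≤ P.L n + 2 / P.δ n := by
        have := P.δ_pos n
        rw [le_add_iff_nonneg_right]
        positivity
      exact mul_le_mul h2 (hgsmall n _ y ⟨hy, P.mem_of_ne_zero hn⟩) (norm_nonneg _) (hden n).le

/-- A `C¹` map which is `R`-Lipschitz on `A`, with derivative bounded by `R` on `A`, is almost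
`R`-Lipschitz on a neighbourhood of `A`. -/
theorem exists_isOpen_lipschitzOnWith_of_contDiff {g : X → Z} (hg : ContDiff ℝ 1 g) {R : ℝ≥0}
    (hL : LipschitzOnWith R g A) (hR : ∀ y ∈ A, ‖fderiv ℝ g y‖ ≤ R) {ε : ℝ≥0} (hε : 0 < ε) :
    ∃ N, IsOpen N ∧ A ⊆ N ∧ LipschitzOnWith (R + ε) g N := by
  have hr : ∀ y : A, ∃ r : ℝ, 0 < r ∧ ∀ x ∈ ball (y : X) r, ‖fderiv ℝ g x‖ ≤ R + ε := by
    rintro ⟨y, hy⟩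
    have h1 : ∀ᶠ x in 𝓝 y, ‖fderiv ℝ g x‖ < R + ε :=
      (hg.continuous_fderiv one_ne_zero).norm.continuousAt.eventually_lt_const
        ((hR y hy).trans_lt (lt_add_of_pos_right _ hε))
    obtain ⟨r, hr, h⟩ := Metric.mem_nhds_iff.1 h1
    exact ⟨r, hr, fun x hx => (h hx).le⟩
  choose r hr0 hr using hr
  have hmv : ∀ y : A, ∀ x ∈ ball (y : X) (r y), ∀ w ∈ ball (y : X) (r y),
      ‖g x - g w‖ ≤ (R + ε) * ‖x - w‖ := fun y x hx w hw =>
    Convex.norm_image_sub_le_of_norm_fderiv_le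
      (fun v _ => hg.differentiable one_ne_zero v) (hr y) (convex_ball _ _) hw hx
  -- The balls are shrunk by τ. If x and w are closer than half of one original radius, τ ≤ 1/2 puts
  -- both in that convex ball. Otherwise the centres are so near that the detour through A, of
  -- excess length at most 4τ‖x - w‖, costs only ε‖x - w‖.
  set τ : ℝ := ε / (4 * (R + R + ε) + 2 * ε) with hτ
  have hε' : (0 : ℝ) < ε := hε
  have hR0 : (0 : ℝ) ≤ R := R.2
  have hτ0 : 0 < τ := by positivity
  have hτ2 : τ ≤ 1 / 2 := by
    rw [hτ, div_le_iff₀ (by positivity)]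
    linarith
  have hτε : (R + R + ε) * (4 * τ) ≤ ε := by
    have h1 : τ * (4 * (R + R + ε) + 2 * ε) = ε := div_mul_cancel₀ _ (by positivity)
    nlinarith
  have hsub : ∀ y : A, ball (y : X) (τ * r y) ⊆ ball (y : X) (r y) := fun y =>
    ball_subset_ball (by nlinarith [hr0 y])
  refine ⟨⋃ y : A, ball (y : X) (τ * r y), isOpen_iUnion fun _ => isOpen_ball, fun y hy =>
    Set.mem_iUnion.2 ⟨⟨y, hy⟩, mem_ball_self (mul_pos hτ0 (hr0 _))⟩,
    LipschitzOnWith.of_dist_le_mul fun x hx w hw => ?_⟩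
  obtain ⟨y, hy⟩ := Set.mem_iUnion.1 hx
  obtain ⟨v, hv⟩ := Set.mem_iUnion.1 hw
  have hy' := mem_ball.1 hy
  have hv' := mem_ball.1 hv
  have hyr := hr0 y
  have hvr := hr0 v
  rw [dist_eq_norm, dist_eq_norm]
  push_cast
  by_cases h1 : dist x w < r y / 2
  · refine hmv y x (hsub y hy) w (mem_ball.2 ?_)
    have := dist_triangle_left w (y : X) x
    nlinarith
  by_cases h2 : dist x w < r v / 2
  · refine hmv v x (mem_ball.2 ?_) w (hsub v hv)
    have := dist_triangle x w (v : X)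
    nlinarith
  push Not at h1 h2
  rw [dist_eq_norm] at h1 h2 hy' hv'
  have h3 := hmv y x (hsub y hy) y (mem_ball_self hyr)
  have h4 := hmv v v (mem_ball_self hvr) w (hsub v hv)
  have h5 := hL.dist_le_mul y y.2 v v.2
  rw [dist_eq_norm, dist_eq_norm] at h5
  have h6 : ‖g x - g w‖ ≤ ‖g x - g y‖ + ‖g y - g v‖ + ‖g v - g w‖ := by
    have : g x - g w = (g x - g y) + (g y - g v) + (g v - g w) := by abel
    rw [this]
    exact norm_add₃_le
  have h7 : ‖(y : X) - v‖ ≤ ‖x - y‖ + ‖x - w‖ + ‖(v : X) - w‖ := by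
    have : (y : X) - v = -(x - y) + (x - w) - (v - w) := by abel
    rw [this]
    refine (norm_sub_le _ _).trans (add_le_add_left ((norm_add_le _ _).trans ?_) _)
    rw [norm_neg]
  rw [norm_sub_rev w] at hv'
  have h8 : ‖x - (y : X)‖ + ‖(v : X) - w‖ ≤ 4 * τ * ‖x - w‖ := by nlinarith
  calc ‖g x - g w‖ ≤ (R + ε) * ‖x - y‖ + R * ‖(y : X) - v‖ + (R + ε) * ‖(v : X) - w‖ := by
        linarith
    _ ≤ (R + ε) * ‖x - y‖ + R * (‖x - y‖ + ‖x - w‖ + ‖(v : X) - w‖)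
        + (R + ε) * ‖(v : X) - w‖ := by gcongr
    _ = R * ‖x - w‖ + (R + R + ε) * (‖x - y‖ + ‖(v : X) - w‖) := by ring
    _ ≤ R * ‖x - w‖ + (R + R + ε) * (4 * τ * ‖x - w‖) := by gcongr
    _ = R * ‖x - w‖ + (R + R + ε) * (4 * τ) * ‖x - w‖ := by ring
    _ ≤ R * ‖x - w‖ + ε * ‖x - w‖ := by gcongr
    _ = (R + ε) * ‖x - w‖ := by ring

theorem lipschitzWith_of_norm_fderiv_le {g : X → Z} (hg : Differentiable ℝ g) {C : ℝ≥0}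
    (h : ∀ x, ‖fderiv ℝ g x‖ ≤ C) : LipschitzWith C g :=
  lipschitzWith_of_nnnorm_fderiv_le hg h

/-- A `C¹` map which is Lipschitz on a neighbourhood of the closed set `A` coincides up to first
order on `A` with a `C¹` map with controlled global Lipschitz constant. -/
theorem exists_contDiff_lipschitzWith_of_isOpen [Nontrivial Z] (hStar : PropertyStar X Z C₀)
    (hE : PropertyE X Z K) (hC₀ : 1 ≤ C₀) (hA : IsClosed A) {g₀ : X → Z} (hg₀ : ContDiff ℝ 1 g₀)
    {N : Set X} (hN : IsOpen N) (hAN : A ⊆ N) {R : ℝ≥0} (hL : LipschitzOnWith R g₀ N)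
    {ε : ℝ≥0} (hε : 0 < ε) :
    ∃ g : X → Z, ContDiff ℝ 1 g ∧ LipschitzWith (C₀ * (K * R) + ε) g ∧ Set.EqOn g g₀ A ∧
      ∀ y ∈ A, fderiv ℝ g y = fderiv ℝ g₀ y := by
  obtain ⟨F, hF, hFN⟩ := hE.exists_extension hL
  let U : Bool → Set X := fun i => bif i then N else Aᶜ
  have hU : ∀ i, IsOpen (U i) := by
    rintro (_ | _)
    · exact hA.isOpen_compl
    · exact hN
  have hcov : ∀ x, ∃ i, x ∈ U i := by
    intro x
    by_cases hx : x ∈ A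
    · exact ⟨true, hAN hx⟩
    · exact ⟨false, hx⟩
  obtain ⟨P⟩ := hStar.exists_discretePartition hU hcov
  have hpos : ∀ n : ℕ, (0 : ℝ) < ε * (1 / 2) ^ (n + 1) / (P.L n + 1) := fun n => by
    have : (0 : ℝ) < ε := hε
    positivity
  choose h hhC hhL hhd using fun n : ℕ =>
    hStar.exists_approx (hF.lipschitzOnWith (s := Set.univ)) (hpos n)
  -- On `N` the piece is `g₀` itself, which equals `F` there; off A it is a smoothing of `F`. All
  -- active values are thus near `F x`, and on A only `g₀` is active.
  let g : ℕ → Bool → X → Z := fun n i => bif i then g₀ else h n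
  have hg : ∀ n i, ContDiff ℝ 1 (g n i) := by
    rintro n (_ | _)
    · exact hhC n
    · exact hg₀
  have hgD : ∀ n i, ∀ x ∈ U i, ‖fderiv ℝ (g n i) x - 0‖ ≤ (C₀ * (K * R) : ℝ≥0) := by
    rintro n (_ | _) x hx
    · rw [sub_zero]
      exact norm_fderiv_le_of_lipschitz ℝ (hhL n)
    · have h1 : g n true =ᶠ[𝓝 x] F :=
        Filter.eventually_of_mem (hN.mem_nhds hx) fun w hw => (hFN hw).symm
      rw [sub_zero, h1.fderiv_eq]
      -- Near x the unsmoothed `F` has constant KR, which `1 ≤ C₀` absorbs into the common bound.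
      refine (norm_fderiv_le_of_lipschitz ℝ hF).trans ?_
      exact_mod_cast le_mul_of_one_le_left zero_le hC₀
  have hgF : ∀ n i, ∀ x ∈ U i, P.L n * ‖g n i x - F x‖ ≤ ε * (1 / 2) ^ (n + 1) := by
    rintro n (_ | _) x hx
    · have h1 := hhd n x trivial
      rw [norm_sub_rev, lt_div_iff₀ (by positivity)] at h1
      have h2 : g n false x = h n x := rfl
      rw [h2]
      nlinarith [norm_nonneg (h n x - F x)]
    · have h1 : g n true x = F x := (hFN hx).symm
      rw [h1, sub_self, norm_zero, mul_zero]
      positivity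
  have hσ : ∀ n, ∀ x ∈ A, P.χ n x ≠ 0 → P.σ n x = true := by
    intro n x hx h1
    by_contra h2
    have h3 := P.mem_of_ne_zero h1
    rw [Bool.not_eq_true] at h2
    rw [h2] at h3
    exact h3 hx
  have hC := P.contDiff_glue hg
  refine ⟨P.glue g, hC, ?_, fun y hy => ?_, fun y hy => ?_⟩
  · refine lipschitzWith_of_norm_fderiv_le (hC.differentiable one_ne_zero) fun x => ?_
    have := P.norm_fderiv_glue_sub_le hg ε.2 (T := 0) (x := x) (p := F x)
      (fun n hn => hgD n _ x (P.mem_of_ne_zero hn)) fun n hn => hgF n _ x (P.mem_of_ne_zero hn)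
    rw [sub_zero] at this
    exact this
  · exact P.glue_eq_of_forall fun n hn => by rw [hσ n y hy hn]; rfl
  · have := P.norm_fderiv_glue_sub_le hg le_rfl (T := fderiv ℝ g₀ y) (x := y) (p := g₀ y)
      (α := 0) (fun n hn => ?_) fun n hn => ?_
    · rw [add_zero] at this
      exact sub_eq_zero.1 (norm_le_zero_iff.1 this)
    · rw [hσ n y hy hn]
      simp [g]
    · rw [hσ n y hy hn]
      simp [g]

/-- `f` satisfies the mean value condition for `D` on `A`, and `R` bounds both its Lipschitz
constant and `D` there. -/
def BoundedMeanValue (A : Set X) (R : ℝ≥0) (f : X → Z) (D : X → X →L[ℝ] Z) : Prop :=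
  MeanValueCondition A f D ∧ LipschitzOnWith R f A ∧ ∀ y ∈ A, ‖D y‖ ≤ R

theorem BoundedMeanValue.exists_approx [Nontrivial Z] (hStar : PropertyStar X Z C₀)
    (hE : PropertyE X Z K) (hC₀ : 1 ≤ C₀) (hA : IsClosed A) {R : ℝ≥0} {f : X → Z}
    {D : X → X →L[ℝ] Z} (h : BoundedMeanValue A R f D) {ε : ℝ≥0} (hε : 0 < ε) (a : X) :
    ∃ g : X → Z, ContDiff ℝ 1 g ∧ LipschitzWith (C₀ * (K * R) + ε) g ∧ g a = f a ∧
      BoundedMeanValue A ε (f - g) (D - fderiv ℝ g) := by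
  obtain ⟨hD, hf, hR⟩ := h
  -- Approximation on A and passage to a neighbourhood each raise R by τ before multiplication by
  -- C₀K; the final gluing adds one more τ.
  set τ : ℝ≥0 := ε / (C₀ * (K * 2) + 1) with hτdef
  have hτ : 0 < τ := by positivity
  have hτε : C₀ * (K * 2) * τ + τ = ε := by
    rw [← add_one_mul, hτdef, mul_div_cancel₀]
    positivity
  have hτle : τ ≤ ε := hτε ▸ le_add_of_nonneg_left zero_le
  obtain ⟨g₀, hg₀, hL₀, hd₀⟩ := hD.exists_contDiff_approx hStar hA hτ
  have h1 : LipschitzOnWith (R + τ) g₀ A := by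
    simpa using hf.sub hL₀
  have h2 : ∀ y ∈ A, ‖fderiv ℝ g₀ y‖ ≤ (R + τ : ℝ≥0) := by
    intro y hy
    have := norm_add_le (D y) (fderiv ℝ g₀ y - D y)
    rw [add_sub_cancel] at this
    push_cast
    linarith [hR y hy, hd₀ y hy]
  obtain ⟨N, hN, hAN, hLN⟩ := exists_isOpen_lipschitzOnWith_of_contDiff hg₀ h1 h2 hτ
  obtain ⟨g, hg, hL, heq, hder⟩ :=
    exists_contDiff_lipschitzWith_of_isOpen hStar hE hC₀ hA hg₀ hN hAN hLN hτ
  have hder' : fderiv ℝ (fun x => g x + (f a - g a)) = fderiv ℝ g := by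
    ext1 x
    rw [fderiv_add_const]
  have hg' : ContDiff ℝ 1 fun x => g x + (f a - g a) := hg.add contDiff_const
  -- The added constant affects no derivative or Lipschitz bound, and makes the residual vanish at
  -- `a`.
  refine ⟨fun x => g x + (f a - g a), hg', ?_, by simp, hD.sub_contDiff hg', ?_, fun y hy => ?_⟩
  · have h3 : C₀ * (K * (R + τ + τ)) + τ = C₀ * (K * R) + ε := by
      rw [← hτε]
      ring
    rw [← h3]
    simpa using hL.add (LipschitzWith.const (f a - g a))
  · refine LipschitzOnWith.of_dist_le_mul fun z hz w hw => ?_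
    have h3 := hL₀.dist_le_mul z hz w hw
    rw [← heq hz, ← heq hw, dist_eq_norm] at h3
    rw [dist_eq_norm]
    calc _ = ‖f z - g z - (f w - g w)‖ := by
          congr 1
          simp only [Pi.sub_apply]
          abel
      _ ≤ τ * dist z w := h3
      _ ≤ ε * dist z w := by gcongr
  · rw [hder', Pi.sub_apply, hder y hy, norm_sub_rev]
    exact (hd₀ y hy).trans hτle

end Approximation

/-! ### Summation of the approximations -/

/-- Summing successive approximations of the residuals: under properties (*) and (E), `f` has a
`C¹` extension whose Lipschitz constant exceeds `C₀ * K * R` by as little as desired. -/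
theorem BoundedMeanValue.exists_extension {X Z : Type*} [NormedAddCommGroup X] [NormedSpace ℝ X]
    [NormedAddCommGroup Z] [NormedSpace ℝ Z] [CompleteSpace Z] [Nontrivial Z] {C₀ K : ℝ≥0}
    {A : Set X} (hStar : PropertyStar X Z C₀) (hE : PropertyE X Z K) (hC₀ : 1 ≤ C₀)
    (hA : IsClosed A) (hne : A.Nonempty) {R : ℝ≥0} {f : X → Z} {D : X → X →L[ℝ] Z}
    (h : BoundedMeanValue A R f D) {c : ℝ≥0} (hc : C₀ * (K * R) < c) :
    ∃ G : X → Z, ContDiff ℝ 1 G ∧ LipschitzWith c G ∧ Set.EqOn G f A := by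
  obtain ⟨a, ha⟩ := hne
  -- The hypotheses are placed after the existential so that `choose` gives a step defined on all
  -- pairs, usable in a recursion before the invariant is proved.
  have hstep : ∀ (ρ ε : ℝ≥0) (p : (X → Z) × (X → X →L[ℝ] Z)), ∃ g : X → Z,
      0 < ε → BoundedMeanValue A ρ p.1 p.2 →
      ContDiff ℝ 1 g ∧ LipschitzWith (C₀ * (K * ρ) + ε) g ∧ g a = p.1 a ∧
        BoundedMeanValue A ε (p.1 - g) (p.2 - fderiv ℝ g) := by
    intro ρ ε p
    by_cases hp : 0 < ε ∧ BoundedMeanValue A ρ p.1 p.2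
    · obtain ⟨g, hg⟩ := hp.2.exists_approx hStar hE hC₀ hA hp.1 a
      exact ⟨g, fun _ _ => hg⟩
    · exact ⟨0, fun h1 h2 => absurd ⟨h1, h2⟩ hp⟩
  choose step hstep using hstep
  -- The residual bounds will be R, η, η/2, …, with sum R + 2η; η is chosen so that the Lipschitz
  -- bounds sum exactly to c.
  obtain ⟨η, hη, hηc⟩ : ∃ η : ℝ≥0, 0 < η ∧ C₀ * (K * (R + η * 2)) + η * 2 = c := by
    refine ⟨(c - C₀ * (K * R)) / (C₀ * (K * 2) + 2), div_pos (tsub_pos_of_lt hc) (by positivity),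
      ?_⟩
    set d := C₀ * (K * 2) + 2 with hd
    have h1 : (c - C₀ * (K * R)) / d * d = c - C₀ * (K * R) := div_mul_cancel₀ _ (by positivity)
    calc _ = C₀ * (K * R) + (c - C₀ * (K * R)) / d * d := by rw [hd]; ring
      _ = c := by rw [h1, add_tsub_cancel_of_le hc.le]
  obtain ⟨ρ, hρ0, hρs⟩ : ∃ ρ : ℕ → ℝ≥0, ρ 0 = R ∧ ∀ n, ρ (n + 1) = η * (1 / 2) ^ n :=
    ⟨fun n => Nat.casesOn n R fun k => η * (1 / 2) ^ k, rfl, fun _ => rfl⟩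
  have hρpos : ∀ n, 0 < ρ (n + 1) := fun n => by rw [hρs]; positivity
  have hgeo : HasSum (fun n => (ρ (n + 1) : ℝ)) (η * 2) := by
    have := hasSum_geometric_two.mul_left (η : ℝ)
    simpa [hρs] using this
  have hρsum : HasSum (fun n => (ρ n : ℝ)) (R + η * 2) := by
    have h1 := (hasSum_nat_add_iff (f := fun n => (ρ n : ℝ)) 1).1 hgeo
    simpa [add_comm, hρ0] using h1
  let u : ℕ → ℝ := fun n => C₀ * (K * ρ n) + ρ (n + 1)
  have hu : HasSum u c := by
    have h1 := ((hρsum.mul_left (K : ℝ)).mul_left (C₀ : ℝ)).add hgeo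
    rw [← hηc]
    push_cast
    exact h1
  let s : ℕ → (X → Z) × (X → X →L[ℝ] Z) := fun n =>
    Nat.rec (f, D) (fun k p => (p.1 - step (ρ k) (ρ (k + 1)) p,
      p.2 - fderiv ℝ (step (ρ k) (ρ (k + 1)) p))) n
  let g : ℕ → X → Z := fun n => step (ρ n) (ρ (n + 1)) (s n)
  have hs1 : ∀ n, (s (n + 1)).1 = (s n).1 - g n := fun n => rfl
  have hs2 : ∀ n, (s (n + 1)).2 = (s n).2 - fderiv ℝ (g n) := fun n => rfl
  have hs : ∀ n, BoundedMeanValue A (ρ n) (s n).1 (s n).2 := by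
    intro n
    induction n with
    | zero => rwa [hρ0]
    | succ n ih =>
      rw [hs1, hs2]
      exact (hstep _ _ _ (hρpos n) ih).2.2.2
  have hg : ∀ n, ContDiff ℝ 1 (g n) := fun n => (hstep _ _ _ (hρpos n) (hs n)).1
  have hgL : ∀ n, LipschitzWith (C₀ * (K * ρ n) + ρ (n + 1)) (g n) := fun n =>
    (hstep _ _ _ (hρpos n) (hs n)).2.1
  have hga : ∀ n, g n a = (s n).1 a := fun n => (hstep _ _ _ (hρpos n) (hs n)).2.2.1
  have hsa : ∀ n, (s (n + 1)).1 a = 0 := fun n => by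
    rw [hs1, Pi.sub_apply, hga, sub_self]
  have hpartial : ∀ n x, ∑ k ∈ Finset.range n, g k x = f x - (s n).1 x := by
    intro n x
    induction n with
    | zero => simp [s]
    | succ n ih =>
      rw [Finset.sum_range_succ, ih, hs1, Pi.sub_apply]
      abel
  have hder : ∀ n x, HasFDerivAt (g n) (fderiv ℝ (g n) x) x := fun n x =>
    ((hg n).differentiable one_ne_zero x).hasFDerivAt
  have hbound : ∀ n x, ‖fderiv ℝ (g n) x‖ ≤ u n := fun n x => by
    have := norm_fderiv_le_of_lipschitz ℝ (hgL n) (x₀ := x)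
    push_cast at this
    exact this
  -- All terms after the first vanish at `a`. Convergence at this one point and summable derivative
  -- bounds give a C¹ sum.
  have hsuma : Summable fun n => g n a := by
    refine summable_of_ne_finset_zero (s := {0}) fun n hn => ?_
    obtain ⟨k, rfl⟩ := Nat.exists_eq_succ_of_ne_zero (by simpa using hn)
    rw [hga, hsa]
  have hG : ∀ x, HasFDerivAt (fun y => ∑' n, g n y) (∑' n, fderiv ℝ (g n) x) x :=
    fun x => hasFDerivAt_tsum hu.summable hder hbound hsuma x
  have hGd : Differentiable ℝ fun y => ∑' n, g n y := fun x => (hG x).differentiableAt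
  have hfd : fderiv ℝ (fun y => ∑' n, g n y) = fun x => ∑' n, fderiv ℝ (g n) x :=
    funext fun x => (hG x).fderiv
  refine ⟨fun y => ∑' n, g n y, contDiff_one_iff_fderiv.2 ⟨hGd, ?_⟩,
    lipschitzWith_of_norm_fderiv_le hGd fun x => ?_, fun y hy => ?_⟩
  · rw [hfd]
    exact continuous_tsum (fun n => (hg n).continuous_fderiv one_ne_zero) hu.summable hbound
  · rw [hfd]
    exact tsum_of_norm_bounded hu fun n => hbound n x
  · have hsum : Summable fun n => g n y :=
      summable_of_summable_hasFDerivAt hu.summable hder hbound hsuma y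
    refine tendsto_nhds_unique hsum.hasSum.tendsto_sum_nat ?_
    -- The residual vanishes at `a`, so its Lipschitz constant on A controls its value at y.
    have hres : Tendsto (fun n => (s n).1 y) atTop (𝓝 0) := by
      rw [← tendsto_add_atTop_iff_nat 1]
      refine squeeze_zero_norm (a := fun n => ρ (n + 1) * dist y a) (fun n => ?_) ?_
      · have := (hs (n + 1)).2.1.dist_le_mul y hy a ha
        rwa [hsa, dist_zero_right] at this
      · simpa using hgeo.summable.tendsto_atTop_zero.mul_const (dist y a)
    simp only [hpartial]
    simpa using hres.const_sub (f y)

theorem theorem3p2 {X Z : Type*}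
    [NormedAddCommGroup X] [NormedSpace ℝ X] [CompleteSpace X]
    [NormedAddCommGroup Z] [NormedSpace ℝ Z] [CompleteSpace Z]
    (C₀ K : ℝ≥0) (hStar : PropertyStar X Z C₀) (hE : PropertyE X Z K)
    (A : Set X) (hA : IsClosed A) (f : X → Z) (D : X → X →L[ℝ] Z)
    (hD : MeanValueCondition A f D)
    (hf : IsLipschitzOn f A) (M : ℝ) (hM : ∀ y ∈ A, ‖D y‖ ≤ M)
    (c : ℝ) (hc : C₀ * K * max M (lipConst f A) < c) :
    ∃ G : X → Z, ContDiff ℝ 1 G ∧ Set.EqOn G f A ∧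
      IsLipschitzOn G Set.univ ∧ lipConst G Set.univ ≤ c := by
  have hc0 : 0 < c := lt_of_le_of_lt
    (mul_nonneg (by positivity) (le_max_of_le_right (NNReal.coe_nonneg _))) hc
  suffices h : ∃ G : X → Z, ContDiff ℝ 1 G ∧ LipschitzWith c.toNNReal G ∧ Set.EqOn G f A by
    obtain ⟨G, hG, hL, heq⟩ := h
    refine ⟨G, hG, heq, ⟨_, hL.lipschitzOnWith⟩, ?_⟩
    have h1 : (lipConst G Set.univ : ℝ) ≤ (c.toNNReal : ℝ) :=
      NNReal.coe_le_coe.2 (lipConst_le hL.lipschitzOnWith)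
    rwa [Real.coe_toNNReal _ hc0.le] at h1
  -- The iteration needs a base point in A, which also forces `0 ≤ M`; `1 ≤ C₀` needs X and Z
  -- nontrivial. The degenerate cases are settled directly.
  rcases A.eq_empty_or_nonempty with rfl | hne
  · exact ⟨0, contDiff_const, LipschitzWith.const' 0, Set.eqOn_empty _ _⟩
  rcases subsingleton_or_nontrivial X with hX | hX
  · exact ⟨f, by
      rw [show f = fun _ => f 0 from funext fun x => congrArg f (Subsingleton.elim x 0)]
      exact contDiff_const,
      LipschitzWith.of_dist_le_mul fun x y => by
        rw [Subsingleton.elim x y, dist_self, dist_self, mul_zero], Set.eqOn_refl _ _⟩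
  rcases subsingleton_or_nontrivial Z with hZ | hZ
  · exact ⟨f, contDiff_of_subsingleton, LipschitzWith.of_dist_le_mul fun x y => by
      rw [Subsingleton.elim (f x) (f y), dist_self]; positivity, Set.eqOn_refl _ _⟩
  have hM0 : 0 ≤ M := (norm_nonneg _).trans (hM _ hne.some_mem)
  refine BoundedMeanValue.exists_extension hStar hE hStar.one_le hA hne
    (R := max M.toNNReal (lipConst f A)) (D := D) ⟨hD, ?_, fun y hy => ?_⟩ ?_
  · exact hf.lipschitzOnWith_lipConst.weaken (le_max_right _ _)
  · rw [NNReal.coe_max, Real.coe_toNNReal _ hM0]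
    exact le_max_of_le_left (hM y hy)
  · rw [← NNReal.coe_lt_coe, Real.coe_toNNReal _ hc0.le, ← mul_assoc]
    push_cast
    rwa [Real.coe_toNNReal _ hM0]
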